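/- Let $G$ be a finite or infinite connected simple graph of maximum valence $3$. Suppose that $G$ has a vertex $v$ of valence $3$ such that every automorphism of $G$ that fixes $v$ fixes each of the three edges incident to $v$ (a vertex of type 1). Then $G$ has a vertex coloring with two colors that is preserved by no automorphism of $G$ other than the identity. More precisely, let the distinguishing number $D(G)$ be the least number of colors in a (not necessarily proper) vertex coloring of $G$ such that the identity is the only color-preserving automorphism of $G$. Then $D(G)=2$ if $G$ has a non-identity automorphism, and $D(G)=1$ otherwise. -/

import Mathlib

namespace SimpleGraph

variable {V : Type*}

/-- The valence (degree) of a vertex, with value `⊤` if the vertex has infinitely many neighbours. -/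
noncomputable def valence (G : SimpleGraph V) (v : V) : ℕ∞ :=
  (G.neighborSet v).encard

/-- The maximum valence `Δ(G)`: the supremum of the valences of the vertices. -/
noncomputable def maxValence (G : SimpleGraph V) : ℕ∞ :=
  ⨆ v, G.valence v

/-- A colouring of the vertices (not necessarily proper) is distinguishing if the only
automorphism of the graph that preserves it is the identity. -/
def IsDistinguishing (G : SimpleGraph V) {α : Type*} (c : V → α) : Prop :=
  ∀ φ : G ≃g G, (∀ v, c (φ v) = c v) → ∀ v, φ v = v

/-- The distinguishing number `D(G)`: the least number of colours of a distinguishing colouring,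
with value `⊤` if no finite number of colours is enough. -/
noncomputable def distinguishingNumber (G : SimpleGraph V) : ℕ∞ :=
  ⨅ n ∈ {n : ℕ | ∃ c : V → Fin n, G.IsDistinguishing c}, (n : ℕ∞)

/-- A vertex is of type 1 if its stabilizer in the automorphism group acts trivially on the
set of edges incident to it. -/
def IsTypeOne (G : SimpleGraph V) (v : V) : Prop :=
  ∀ φ : G ≃g G, φ v = v → ∀ e ∈ G.incidenceSet v, Sym2.map φ e = e

end SimpleGraph

/-! The colouring is built outwards from the type-1 vertex `v`. An automorphism that fixes `v` and
everything closer to `v` than `a` can move `a` to at most one other vertex, because the valences are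
at most three and `v` is of type 1; so colouring one vertex black in each pair of such mates breaks
every automorphism that fixes `v`. In addition `v` and its neighbours are black, except for a
neighbour with the same closed neighbourhood as `v`. Among all ways to choose from the mates, one
takes a way that is locally optimal on each sphere about `v`; then no vertex other than `v` has
`v`'s colour and surroundings, so every colour-preserving automorphism fixes `v`. -/

open Function Set SimpleGraph

namespace TypeOneColoring

section Transversal

variable {α ι : Type*} {σ : α → α} {T : Set α} {H : SimpleGraph α}

/-- A set that contains exactly one point of each two-point orbit of an involution `σ`, and no
fixed point of `σ`. -/
structure IsTransversal (σ : α → α) (T : Set α) : Prop where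
  map_notMem : ∀ a ∈ T, σ a ∉ T
  mem_or_map_mem : ∀ a, σ a ≠ a → a ∈ T ∨ σ a ∈ T

theorem IsTransversal.map_ne (hT : IsTransversal σ T) {a : α} (ha : a ∈ T) : σ a ≠ a :=
  fun h => hT.map_notMem a ha (h.symm ▸ ha)

theorem exists_isTransversal (hσ : Involutive σ) : ∃ T, IsTransversal σ T := by
  classical
  let := linearOrderOfSTO (WellOrderingRel (α := α))
  refine ⟨{a | a < σ a}, fun a ha => ?_, fun a ha => ?_⟩
  · simpa only [mem_ofPred_eq, hσ a, not_lt] using le_of_lt ha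
  · simpa only [mem_ofPred_eq, hσ a] using lt_or_gt_of_ne ha.symm

theorem IsTransversal.flip (hσ : Involutive σ) (hT : IsTransversal σ T) {a : α} (ha : a ∈ T) :
    IsTransversal σ (insert (σ a) (T \ {a})) := by
  have hne := hT.map_ne ha
  refine ⟨fun c hc => ?_, fun c hc => ?_⟩
  · rcases hc with rfl | ⟨hcT, hca⟩
    · simp [hσ a, hne.symm]
    · simp [hσ.injective.eq_iff, show c ≠ a from hca, hT.map_notMem c hcT]
  · have := hT.mem_or_map_mem c hc
    by_cases hca : c = a
    · simp [hca]
    · by_cases hσca : σ c = a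
      · simp [← hσca, hσ c]
      · simpa [hca, hσca] using Or.imp Or.inr Or.inr this

/-- A transversal of `σ` in which no vertex is surrounded: a vertex of `T` with at least one
`H`-neighbour has an `H`-neighbour outside `T`. -/
structure IsSeparatingTransversal (H : SimpleGraph α) (σ : α → α) (T : Set α) : Prop
    extends IsTransversal σ T where
  exists_adj_notMem : ∀ a ∈ T, ∀ b, H.Adj a b → ∃ c ∉ T, H.Adj a c

theorem exists_isSeparatingTransversal [Finite α] (hσ : Involutive σ)
    (hH : ∀ a b, H.Adj a b → H.Adj (σ a) (σ b)) : ∃ T, IsSeparatingTransversal H σ T := by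
  -- Take a transversal that induces a minimal subgraph: a surrounded vertex could be flipped.
  obtain ⟨T, hT, hmin⟩ := exists_minimalFor_of_wellFoundedLT (IsTransversal σ)
    (fun T => (H.induce T).spanningCoe) (exists_isTransversal hσ)
  refine ⟨T, hT, fun a ha b hab => ?_⟩
  by_contra! hsurrounded
  have hnbrs : ∀ c, H.Adj a c → c ∈ T := fun c => not_imp_not.1 (hsurrounded c)
  have hisolated : ∀ c ∈ T, ¬ H.Adj (σ a) c := fun c hc hac =>
    hT.map_notMem c hc (hnbrs (σ c) (hσ a ▸ hH _ _ hac))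
  have hle : (H.induce (insert (σ a) (T \ {a}))).spanningCoe ≤ (H.induce T).spanningCoe := by
    intro x y hxy
    simp only [map_adj, comap_adj, Embedding.subtype_apply, Subtype.exists, mem_insert_iff,
      mem_sdiff, mem_singleton_iff, exists_and_left, exists_prop, ↓existsAndEq, and_true,
      true_and] at hxy ⊢
    grind [H.adj_comm, H.irrefl]
  have hadj : (H.induce T).spanningCoe.Adj a b := by
    simpa [ha, hab] using hnbrs b hab
  have := hmin (hT.flip hσ ha) hle hadj
  simp [(hT.map_ne ha).symm] at this

theorem exists_isSeparatingTransversal_of_finite_fibers {f : α → ι}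
    (hf : ∀ i, (f ⁻¹' {i}).Finite) (hσ : Involutive σ) (hσf : ∀ a, f (σ a) = f a)
    (hH : ∀ a b, H.Adj a b → H.Adj (σ a) (σ b)) (hHf : ∀ a b, H.Adj a b → f a = f b) :
    ∃ T, IsSeparatingTransversal H σ T := by
  have hmaps : ∀ i, MapsTo σ (f ⁻¹' {i}) (f ⁻¹' {i}) := fun i a ha => (hσf a).trans ha
  have hfiber : ∀ i, ∃ T : Set (f ⁻¹' {i}),
      IsSeparatingTransversal (H.induce (f ⁻¹' {i})) ((hmaps i).restrict σ _ _) T := fun i =>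
    have := (hf i).to_subtype
    exists_isSeparatingTransversal (fun a => Subtype.ext (hσ a)) fun a b => hH a b
  choose T hT using hfiber
  have hglue : ∀ {i} (a : f ⁻¹' {i}), (⟨a, rfl⟩ : f ⁻¹' {f a}) ∈ T (f a) ↔ a ∈ T i := by
    rintro _ ⟨a, rfl⟩
    rfl
  refine ⟨{a | (⟨a, rfl⟩ : f ⁻¹' {f a}) ∈ T (f a)}, ⟨fun a ha hσa => ?_, fun a ha => ?_⟩,
    fun a ha b hab => ?_⟩
  · exact (hT _).map_notMem _ ha ((hglue ((hmaps (f a)).restrict σ _ _ ⟨a, rfl⟩)).1 hσa)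
  · exact ((hT _).mem_or_map_mem ⟨a, rfl⟩ fun h => ha (congrArg Subtype.val h)).imp_right
      (hglue ((hmaps (f a)).restrict σ _ _ ⟨a, rfl⟩)).2
  · obtain ⟨c, hc, hac⟩ := (hT _).exists_adj_notMem _ ha ⟨b, (hHf a b hab).symm⟩ hab
    exact ⟨c, mt (hglue c).1 hc, hac⟩

end Transversal

section Distance

variable {V W : Type*} {G : SimpleGraph V} {v p q a b : V}

theorem dist_iso_apply {G' : SimpleGraph W} (φ : G ≃g G') (a b : V) :
    G'.dist (φ a) (φ b) = G.dist a b := by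
  rw [dist_eq_sInf, dist_eq_sInf]
  congr 1
  ext n
  constructor
  · rintro ⟨w, rfl⟩
    exact ⟨(w.map φ.symm.toHom).copy (φ.symm_apply_apply a) (φ.symm_apply_apply b), by simp⟩
  · rintro ⟨w, rfl⟩
    exact ⟨w.map φ.toHom, by simp⟩

theorem ne_root_of_dist_pos (G : SimpleGraph V) (h : 0 < G.dist v a) : a ≠ v := by
  rintro rfl
  simp at h

theorem dist_apply_of_fixes_root {φ : G ≃g G} (hφ : φ v = v) (u : V) :
    G.dist v (φ u) = G.dist v u := by
  simpa only [hφ] using dist_iso_apply φ v u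

/-- `p` is a parent of `a` with respect to the root `v`: a neighbour that is closer to `v`. -/
structure IsParent (G : SimpleGraph V) (v p a : V) : Prop where
  adj : G.Adj p a
  dist_eq : G.dist v a = G.dist v p + 1

theorem IsParent.map (h : IsParent G v p a) {φ : G ≃g G} (hφ : φ v = v) :
    IsParent G v (φ p) (φ a) where
  adj := φ.map_adj_iff.2 h.adj
  dist_eq := by simpa only [dist_apply_of_fixes_root hφ] using h.dist_eq

theorem exists_isParent (hconn : G.Connected) (ha : 0 < G.dist v a) :
    ∃ p, IsParent G v p a := by
  obtain ⟨w, hw⟩ := hconn.exists_walk_length_eq_dist a v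
  cases w with
  | nil => simp at ha
  | @cons _ p _ hap w =>
    refine ⟨p, hap.symm, ?_⟩
    have hp : G.dist v p ≤ w.length := by
      rw [dist_comm]
      exact dist_le w
    have hadj := hap.symm.diff_dist_adj (u := v)
    rw [Walk.length_cons, dist_comm] at hw
    lia

theorem exists_isParent_isParent (hconn : G.Connected) (ha : 2 ≤ G.dist v a) :
    ∃ q p, IsParent G v q p ∧ IsParent G v p a := by
  obtain ⟨p, hp⟩ := exists_isParent hconn (two_pos.trans_le ha)
  obtain ⟨q, hq⟩ := exists_isParent hconn (v := v) (a := p) (by have := hp.dist_eq; lia)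
  exact ⟨q, p, hq, hp⟩

theorem finite_sphere (hconn : G.Connected) (hfin : ∀ u, (G.neighborSet u).Finite) (v : V)
    (n : ℕ) : (G.dist v ⁻¹' {n}).Finite := by
  induction n with
  | zero => exact (finite_singleton v).subset fun u hu => (hconn.dist_eq_zero_iff.1 hu).symm
  | succ n ih =>
    refine (ih.biUnion fun u _ => hfin u).subset fun u (hu : G.dist v u = n + 1) => ?_
    obtain ⟨p, hp⟩ := exists_isParent hconn (v := v) (a := u) (by lia)
    exact mem_biUnion (show G.dist v p = n by have := hp.dist_eq; lia) hp.adj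

/-- The closed neighbourhood of a vertex: the vertex together with its neighbours. -/
def closedNbhd (G : SimpleGraph V) (u : V) : Set V :=
  insert u (G.neighborSet u)

theorem encard_closedNbhd (G : SimpleGraph V) (u : V) :
    (closedNbhd G u).encard = G.valence u + 1 :=
  encard_insert_of_notMem (G.notMem_neighborSet_self)

theorem closedNbhd_apply (φ : G ≃g G) (u : V) : closedNbhd G (φ u) = φ '' closedNbhd G u := by
  ext z
  obtain ⟨z, rfl⟩ := φ.surjective z
  simp [closedNbhd, φ.map_adj_iff, φ.injective.eq_iff]

theorem valence_apply (φ : G ≃g G) (u : V) : G.valence (φ u) = G.valence u :=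
  (encard_congr (φ.mapNeighborSet u)).symm

theorem dist_le_of_closedNbhd_eq (hconn : G.Connected) (ha : a ≠ v)
    (h : closedNbhd G b = closedNbhd G a) : G.dist v b ≤ G.dist v a := by
  obtain ⟨p, hpa⟩ := exists_isParent hconn (hconn.pos_dist_of_ne ha.symm)
  have hpd := hpa.dist_eq
  have hpb : p ∈ closedNbhd G b := h ▸ Or.inr hpa.adj.symm
  rcases hpb with rfl | hbp
  · lia
  · have := (G.adj_symm hbp).diff_dist_adj (u := v)
    lia

theorem neighborSet_eq_of_adj {c : V} (hp : G.valence p ≤ 3) (ha : G.Adj p a) (hb : G.Adj p b)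
    (hc : G.Adj p c) (hab : a ≠ b) (hac : a ≠ c) (hbc : b ≠ c) : G.neighborSet p = {a, b, c} := by
  have hsub : ({a, b, c} : Set V) ⊆ G.neighborSet p := by
    rintro z (rfl | rfl | rfl) <;> assumption
  refine ((toFinite _).eq_of_subset_of_encard_le hsub (hp.trans_eq ?_)).symm
  exact (encard_eq_three.2 ⟨a, b, c, hab, hac, hbc, rfl⟩).symm

end Distance

section Mates

variable {V : Type*} {G : SimpleGraph V} {v p q a b c : V}

theorem apply_eq_of_isTypeOne (htype : G.IsTypeOne v) {φ : G ≃g G} (hφ : φ v = v)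
    (ha : G.Adj v a) : φ a = a := by
  have hedge := htype φ hφ s(v, a) (G.mk'_mem_incidenceSet_left_iff.2 ha)
  rw [Sym2.map_mk, hφ] at hedge
  exact Sym2.congr_right.1 hedge

/-- `b` is a mate of `a` with respect to the root `v` if some automorphism moves `a` to `b` and
fixes `v` and all vertices that are closer to `v` than `a` is. -/
def Mate (G : SimpleGraph V) (v a b : V) : Prop :=
  ∃ φ : G ≃g G, φ v = v ∧ (∀ u, G.dist v u < G.dist v a → φ u = u) ∧ φ a = b

namespace Mate

theorem refl (G : SimpleGraph V) (v a : V) : Mate G v a a :=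
  ⟨Iso.refl, rfl, fun _ _ => rfl, rfl⟩

theorem dist_eq (h : Mate G v a b) : G.dist v b = G.dist v a := by
  obtain ⟨φ, hv, -, rfl⟩ := h
  exact dist_apply_of_fixes_root hv a

theorem symm (h : Mate G v a b) : Mate G v b a := by
  have hd := h.dist_eq
  obtain ⟨φ, hv, hfix, rfl⟩ := h
  refine ⟨φ.symm, ?_, fun u hu => ?_, φ.symm_apply_apply a⟩
  · exact φ.symm_apply_eq.2 hv.symm
  · exact φ.symm_apply_eq.2 (hfix u (hd ▸ hu)).symm

theorem map (h : Mate G v a b) {ψ : G ≃g G} (hψ : ψ v = v) : Mate G v (ψ a) (ψ b) := by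
  obtain ⟨φ, hv, hfix, rfl⟩ := h
  have hψ' : ψ.symm v = v := ψ.symm_apply_eq.2 hψ.symm
  refine ⟨(ψ.symm.trans φ).trans ψ, ?_, fun u hu => ?_, ?_⟩
  · simp only [RelIso.trans_apply, hψ', hv, hψ]
  · rw [dist_apply_of_fixes_root hψ, ← dist_apply_of_fixes_root hψ'] at hu
    simp only [RelIso.trans_apply, hfix _ hu, ψ.apply_symm_apply]
  · simp only [RelIso.trans_apply, ψ.symm_apply_apply]

theorem isParent (h : Mate G v a b) (hp : IsParent G v p a) : IsParent G v p b := by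
  obtain ⟨φ, hv, hfix, rfl⟩ := h
  simpa only [hfix p (by have := hp.dist_eq; lia)] using hp.map hv

theorem eq_of_dist_lt_two (hconn : G.Connected) (htype : G.IsTypeOne v) (h : Mate G v a b)
    (ha : G.dist v a < 2) : b = a := by
  obtain ⟨φ, hv, -, rfl⟩ := h
  obtain h0 | h1 : G.dist v a = 0 ∨ G.dist v a = 1 := by lia
  · rwa [← hconn.dist_eq_zero_iff.1 h0]
  · exact apply_eq_of_isTypeOne htype hv (dist_eq_one_iff_adj.1 h1)

theorem neighborSet_parent_eq (hle : ∀ u, G.valence u ≤ 3) (h : Mate G v a b) (hne : b ≠ a)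
    (hq : IsParent G v q p) (hp : IsParent G v p a) : G.neighborSet p = {q, a, b} := by
  have hqd := hq.dist_eq
  have hpd := hp.dist_eq
  have hbd := h.dist_eq
  exact neighborSet_eq_of_adj (hle p) hq.adj.symm hp.adj (h.isParent hp).adj
    (by rintro rfl; lia) (by rintro rfl; lia) hne.symm

theorem eq_of_ne (hconn : G.Connected) (hle : ∀ u, G.valence u ≤ 3) (htype : G.IsTypeOne v)
    (hab : Mate G v a b) (hac : Mate G v a c) (hb : b ≠ a) (hc : c ≠ a) : b = c := by
  have ha : 2 ≤ G.dist v a := not_lt.1 fun ha => hb (hab.eq_of_dist_lt_two hconn htype ha)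
  obtain ⟨q, p, hq, hp⟩ := exists_isParent_isParent hconn ha
  have hpd := hp.dist_eq
  have hqd := hq.dist_eq
  have hcd := hac.dist_eq
  have hcN : c ∈ ({q, a, b} : Set V) :=
    hab.neighborSet_parent_eq hle hb hq hp ▸ (hac.isParent hp).adj
  rcases hcN with rfl | rfl | rfl
  · lia
  · exact absurd rfl hc
  · rfl

theorem of_twins (ha : a ≠ v) (hb : b ≠ v) (hd : G.dist v a ≤ G.dist v b)
    (h : ∀ z, z ≠ a → z ≠ b → (G.Adj a z ↔ G.Adj b z)) : Mate G v a b := by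
  classical
  refine ⟨⟨Equiv.swap a b, fun {x y} => ?_⟩, Equiv.swap_apply_of_ne_of_ne ha.symm hb.symm,
    fun u hu => Equiv.swap_apply_of_ne_of_ne ?_ ?_, Equiv.swap_apply_left a b⟩
  · simp only [Equiv.swap_apply_def]
    grind [G.adj_comm, G.irrefl]
  · rintro rfl; lia
  · rintro rfl; lia

end Mate

open Classical in
/-- The mate of `a` other than `a` itself if there is one, and `a` otherwise. -/
noncomputable def partner (G : SimpleGraph V) (v a : V) : V :=
  if h : ∃ b, Mate G v a b ∧ b ≠ a then h.choose else a

theorem mate_partner (G : SimpleGraph V) (v a : V) : Mate G v a (partner G v a) := by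
  unfold partner
  split_ifs with h
  · exact h.choose_spec.1
  · exact Mate.refl G v a

theorem Mate.eq_partner (hconn : G.Connected) (hle : ∀ u, G.valence u ≤ 3)
    (htype : G.IsTypeOne v) (h : Mate G v a b) (hne : b ≠ a) : b = partner G v a := by
  have hex : ∃ b, Mate G v a b ∧ b ≠ a := ⟨b, h, hne⟩
  rw [partner, dif_pos hex]
  exact h.eq_of_ne hconn hle htype hex.choose_spec.1 hne hex.choose_spec.2

theorem partner_involutive (hconn : G.Connected) (hle : ∀ u, G.valence u ≤ 3)
    (htype : G.IsTypeOne v) : Involutive (partner G v) := by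
  intro a
  by_cases h : partner G v a = a
  · rw [h, h]
  · exact ((mate_partner G v a).symm.eq_partner hconn hle htype (Ne.symm h)).symm

theorem two_le_dist_of_partner_ne (hconn : G.Connected) (htype : G.IsTypeOne v)
    (ha : partner G v a ≠ a) : 2 ≤ G.dist v a :=
  not_lt.1 fun h => ha ((mate_partner G v a).eq_of_dist_lt_two hconn htype h)

theorem apply_partner_of_apply_eq (hconn : G.Connected) (hle : ∀ u, G.valence u ≤ 3)
    (htype : G.IsTypeOne v) {φ : G ≃g G} (hφ : φ v = v) (ha : φ a = a) :
    φ (partner G v a) = partner G v a := by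
  have hmate : Mate G v a (φ (partner G v a)) := by
    simpa only [ha] using (mate_partner G v a).map hφ
  by_cases hne : φ (partner G v a) = a
  · rw [φ.injective (hne.trans ha.symm), ha]
  · exact hmate.eq_partner hconn hle htype hne

theorem exists_iso_apply_eq_partner (hconn : G.Connected) (hle : ∀ u, G.valence u ≤ 3)
    (htype : G.IsTypeOne v) (hd : G.dist v a = G.dist v b) :
    ∃ φ : G ≃g G, φ v = v ∧ φ a = partner G v a ∧ φ b = partner G v b := by
  obtain ⟨φ, hφv, hφ, hφa⟩ := mate_partner G v a
  obtain ⟨ψ, hψv, hψ, hψb⟩ := mate_partner G v b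
  by_cases hφb : φ b = b
  · by_cases hψa : ψ a = a
    · refine ⟨ψ.trans φ, by simp [hφv, hψv], by simp [hψa, hφa], ?_⟩
      rw [RelIso.trans_apply, hψb, apply_partner_of_apply_eq hconn hle htype hφv hφb]
    · exact ⟨ψ, hψv, Mate.eq_partner hconn hle htype ⟨ψ, hψv, by rwa [hd], rfl⟩ hψa, hψb⟩
  · exact ⟨φ, hφv, hφa, Mate.eq_partner hconn hle htype ⟨φ, hφv, by rwa [← hd], rfl⟩ hφb⟩

/-- Joins two vertices on the same sphere about `v` that are not mates and that are adjacent or have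
a common child. These are the pairs that should not both be selected. -/
def conflictGraph (G : SimpleGraph V) (v : V) : SimpleGraph V where
  Adj a b := G.dist v a = G.dist v b ∧ ¬ Mate G v a b ∧
    (G.Adj a b ∨ ∃ c, IsParent G v a c ∧ IsParent G v b c)
  symm := ⟨fun _ _ ⟨hd, hm, h⟩ => ⟨hd.symm, fun h' => hm h'.symm,
    h.imp (fun h => h.symm) fun ⟨c, ha, hb⟩ => ⟨c, hb, ha⟩⟩⟩
  loopless := ⟨fun a h => h.2.1 (Mate.refl G v a)⟩

theorem conflictGraph_adj_map {φ : G ≃g G} (hφ : φ v = v) (h : (conflictGraph G v).Adj a b) :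
    (conflictGraph G v).Adj (φ a) (φ b) := by
  obtain ⟨hd, hm, h⟩ := h
  refine ⟨by simpa only [dist_apply_of_fixes_root hφ] using hd, fun h' => hm ?_, ?_⟩
  · simpa using h'.map (φ.symm_apply_eq.2 hφ.symm)
  · exact h.imp φ.map_adj_iff.2 fun ⟨c, ha, hb⟩ => ⟨φ c, ha.map hφ, hb.map hφ⟩

theorem conflictGraph_adj_partner (hconn : G.Connected) (hle : ∀ u, G.valence u ≤ 3)
    (htype : G.IsTypeOne v) (h : (conflictGraph G v).Adj a b) :
    (conflictGraph G v).Adj (partner G v a) (partner G v b) := by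
  obtain ⟨φ, hφv, hφa, hφb⟩ := exists_iso_apply_eq_partner hconn hle htype h.1
  rw [← hφa, ← hφb]
  exact conflictGraph_adj_map hφv h

/-- A selection of one vertex from each pair of distinct mates that has no surrounded vertex in the
conflict graph. -/
abbrev IsSelection (G : SimpleGraph V) (v : V) (T : Set V) : Prop :=
  IsSeparatingTransversal (conflictGraph G v) (partner G v) T

theorem exists_isSelection (hconn : G.Connected) (hle : ∀ u, G.valence u ≤ 3)
    (htype : G.IsTypeOne v) : ∃ T, IsSelection G v T :=
  exists_isSeparatingTransversal_of_finite_fibers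
    (finite_sphere hconn (fun u => finite_of_encard_le_coe (hle u)) v)
    (partner_involutive hconn hle htype) (fun a => (mate_partner G v a).dist_eq)
    (fun _ _ => conflictGraph_adj_partner hconn hle htype) (fun _ _ h => h.1)

end Mates

section Coloring

variable {V : Type*} {G : SimpleGraph V} {v x y p q : V} {T : Set V}

/-- The black vertices of the colouring determined by a selection `T`. -/
def blackSet (G : SimpleGraph V) (v : V) (T : Set V) : Set V :=
  {u | u = v ∨ (G.Adj v u ∧ closedNbhd G u ≠ closedNbhd G v) ∨ u ∈ T}

theorem two_le_dist_of_mem (hconn : G.Connected) (htype : G.IsTypeOne v)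
    (hT : IsSelection G v T) (hx : x ∈ T) : 2 ≤ G.dist v x :=
  two_le_dist_of_partner_ne hconn htype (hT.map_ne hx)

theorem mem_blackSet_iff (hx : 2 ≤ G.dist v x) : x ∈ blackSet G v T ↔ x ∈ T := by
  refine ⟨fun h => ?_, fun h => Or.inr (Or.inr h)⟩
  rcases h with rfl | ⟨hvx, -⟩ | h
  · simp at hx
  · rw [dist_eq_one_iff_adj.2 hvx] at hx
    lia
  · exact h

/-- The properties of the root that are visible in the colouring with black set `blackSet G v T`
without knowing which vertex is the root. -/
structure IsRootLike (G : SimpleGraph V) (v : V) (T : Set V) (x : V) : Prop where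
  mem_blackSet : x ∈ blackSet G v T
  valence_eq : G.valence x = G.valence v
  mem_or_closedNbhd_eq : ∀ y, G.Adj x y → y ∈ blackSet G v T ∨ closedNbhd G y = closedNbhd G x

theorem isRootLike_apply_root {φ : G ≃g G}
    (hφ : ∀ u, φ u ∈ blackSet G v T ↔ u ∈ blackSet G v T) : IsRootLike G v T (φ v) where
  mem_blackSet := (hφ v).2 (Or.inl rfl)
  valence_eq := valence_apply φ v
  mem_or_closedNbhd_eq y hy := by
    obtain ⟨y, rfl⟩ := φ.surjective y
    rw [φ.map_adj_iff] at hy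
    rw [closedNbhd_apply, closedNbhd_apply, φ.injective.image_injective.eq_iff, hφ]
    by_cases h : closedNbhd G y = closedNbhd G v
    · exact Or.inr h
    · exact Or.inl (Or.inr (Or.inl ⟨hy, h⟩))

namespace IsRootLike

theorem mem_blackSet_of_adj (hconn : G.Connected) (hx : IsRootLike G v T x) (hxv : x ≠ v)
    (hyv : y ≠ v) (hxy : G.Adj x y) (hd : G.dist v y ≠ G.dist v x) : y ∈ blackSet G v T :=
  (hx.mem_or_closedNbhd_eq y hxy).resolve_right fun h =>
    hd ((dist_le_of_closedNbhd_eq hconn hxv h).antisymm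
      (dist_le_of_closedNbhd_eq hconn hyv h.symm))

theorem not_isParent (hconn : G.Connected) (hT : IsSelection G v T) (hx : IsRootLike G v T x)
    (hxv : x ≠ v) : ¬ IsParent G v x y := by
  have hchild : ∀ z, IsParent G v x z → z ∈ T := fun z hz => by
    have hpos := hconn.pos_dist_of_ne hxv.symm
    have hd := hz.dist_eq
    exact (mem_blackSet_iff (by lia)).1
      (hx.mem_blackSet_of_adj hconn hxv (ne_root_of_dist_pos G (by lia)) hz.adj (by lia))
  intro hy
  exact hT.map_notMem y (hchild y hy) (hchild _ ((mate_partner G v y).isParent hy))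

theorem dist_ne_one (hconn : G.Connected) (hfin : (G.neighborSet v).Finite)
    (htype : G.IsTypeOne v) (hT : IsSelection G v T) (hx : IsRootLike G v T x) :
    G.dist v x ≠ 1 := by
  intro hd
  have hvx : G.Adj v x := dist_eq_one_iff_adj.1 hd
  have hne : closedNbhd G x ≠ closedNbhd G v := by
    rcases hx.mem_blackSet with rfl | h | h
    · exact absurd hvx G.irrefl
    · exact h.2
    · have := two_le_dist_of_mem hconn htype hT h
      lia
  have hsub : closedNbhd G x ⊆ closedNbhd G v := by
    rintro z (rfl | hz)
    · exact Or.inr hvx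
    · have hchild : G.dist v z ≠ G.dist v x + 1 := fun h =>
        hx.not_isParent hconn hT hvx.ne' ⟨hz, h⟩
      have hz' := (G.mem_neighborSet x z).1 hz |>.diff_dist_adj (u := v)
      obtain h | h : G.dist v z = 0 ∨ G.dist v z = 1 := by lia
      · exact Or.inl (hconn.dist_eq_zero_iff.1 h).symm
      · exact Or.inr (dist_eq_one_iff_adj.1 h)
  have hcard : (closedNbhd G v).encard = (closedNbhd G x).encard := by
    rw [encard_closedNbhd, encard_closedNbhd, hx.valence_eq]
  exact hne ((hfin.insert v).eq_of_subset_of_encard_le' hsub hcard.le)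

theorem mate_of_adj_of_dist_eq (hconn : G.Connected) (hT : IsSelection G v T)
    (hx : IsRootLike G v T x) (hx2 : 2 ≤ G.dist v x) (hxy : G.Adj x y)
    (hd : G.dist v x = G.dist v y) : Mate G v x y := by
  by_contra hm
  have hxv := ne_root_of_dist_pos G (two_pos.trans_le hx2)
  obtain ⟨b, hbT, hb, hbm, hxb⟩ :=
    hT.exists_adj_notMem x ((mem_blackSet_iff hx2).1 hx.mem_blackSet) y ⟨hd, hm, Or.inl hxy⟩
  rcases hxb with hxb | ⟨c, hc, -⟩
  · rcases hx.mem_or_closedNbhd_eq b hxb with h | h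
    · exact hbT ((mem_blackSet_iff (hb ▸ hx2)).1 h)
    · refine hbm (Mate.of_twins hxv (ne_root_of_dist_pos G (by lia)) hb.le fun z hzx hzb => ?_)
      have := Set.ext_iff.1 h z
      simpa [closedNbhd, hzx, hzb] using this.symm
  · exact hx.not_isParent hconn hT hxv hc

theorem exists_two_parents (hconn : G.Connected) (hle : ∀ u, G.valence u ≤ 3)
    (hv : G.valence v = 3) (htype : G.IsTypeOne v) (hT : IsSelection G v T)
    (hx : IsRootLike G v T x) (hx2 : 2 ≤ G.dist v x) :
    ∃ p₁ p₂, IsParent G v p₁ x ∧ IsParent G v p₂ x ∧ p₁ ≠ p₂ := by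
  have hsub : G.neighborSet x ⊆ insert (partner G v x) {p | IsParent G v p x} := by
    intro y hxy
    rw [mem_neighborSet] at hxy
    have hchild : G.dist v y ≠ G.dist v x + 1 := fun h =>
      hx.not_isParent hconn hT (ne_root_of_dist_pos G (by lia)) ⟨hxy, h⟩
    by_cases hd : G.dist v x = G.dist v y
    · exact Or.inl ((hx.mate_of_adj_of_dist_eq hconn hT hx2 hxy hd).eq_partner hconn hle htype
        hxy.ne')
    · have := hxy.diff_dist_adj (u := v)
      exact Or.inr ⟨hxy.symm, by lia⟩
  have hcard : 2 + 1 ≤ {p | IsParent G v p x}.encard + 1 :=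
    calc 2 + 1 = G.valence x := by rw [hx.valence_eq, hv]; norm_num
      _ ≤ (insert (partner G v x) {p | IsParent G v p x}).encard := encard_mono hsub
      _ ≤ {p | IsParent G v p x}.encard + 1 := encard_insert_le _ _
  have htwo : 1 < {p | IsParent G v p x}.encard :=
    (by norm_num : (1 : ℕ∞) < 2).trans_le ((ENat.add_le_add_iff_right ENat.one_ne_top).1 hcard)
  exact one_lt_encard_iff.1 htwo

theorem dist_ne_two (hconn : G.Connected) (hle : ∀ u, G.valence u ≤ 3)
    (hv : G.valence v = 3) (htype : G.IsTypeOne v) (hT : IsSelection G v T)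
    (hx : IsRootLike G v T x) : G.dist v x ≠ 2 := by
  intro hd
  obtain ⟨p₁, p₂, hp₁, hp₂, hne⟩ := hx.exists_two_parents hconn hle hv htype hT hd.ge
  have hxT := (mem_blackSet_iff hd.ge).1 hx.mem_blackSet
  have hparent : ∀ p, IsParent G v p x →
      p ≠ v ∧ G.dist v p = 1 ∧ G.neighborSet p = {v, x, partner G v x} := fun p hp => by
    have hpd : G.dist v p = 1 := by have := hp.dist_eq; lia
    have hvp : IsParent G v v p := ⟨dist_eq_one_iff_adj.1 hpd, by simp [hpd]⟩
    exact ⟨hvp.adj.ne', hpd,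
      (mate_partner G v x).neighborSet_parent_eq hle (hT.map_ne hxT) hvp hp⟩
  obtain ⟨hp₁v, hd₁, hN₁⟩ := hparent p₁ hp₁
  obtain ⟨hp₂v, hd₂, hN₂⟩ := hparent p₂ hp₂
  have hmate : Mate G v p₁ p₂ := Mate.of_twins hp₁v hp₂v (hd₁.trans hd₂.symm).le fun z _ _ => by
    rw [← mem_neighborSet, ← mem_neighborSet, hN₁, hN₂]
  exact hne (hmate.eq_of_dist_lt_two hconn htype (by lia)).symm

theorem dist_lt_three (hconn : G.Connected) (hle : ∀ u, G.valence u ≤ 3)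
    (hv : G.valence v = 3) (htype : G.IsTypeOne v) (hT : IsSelection G v T)
    (hx : IsRootLike G v T x) : G.dist v x < 3 := by
  by_contra! hd
  have hxT := (mem_blackSet_iff (by lia)).1 hx.mem_blackSet
  have hparent : ∀ p, IsParent G v p x → p ∈ T := fun p hp => by
    have hpd := hp.dist_eq
    exact (mem_blackSet_iff (by lia)).1 (hx.mem_blackSet_of_adj hconn
      (ne_root_of_dist_pos G (by lia)) (ne_root_of_dist_pos G (by lia)) hp.adj.symm (by lia))
  obtain ⟨p₁, p₂, hp₁, hp₂, hne⟩ := hx.exists_two_parents hconn hle hv htype hT (by lia)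
  have hnotMate : ¬ Mate G v p₁ p₂ := fun h =>
    hT.map_notMem p₁ (hparent p₁ hp₁)
      (h.eq_partner hconn hle htype hne.symm ▸ hparent p₂ hp₂)
  have hd₁ := hp₁.dist_eq
  have hd₂ := hp₂.dist_eq
  obtain ⟨b, hbT, hbd, -, hb⟩ := hT.exists_adj_notMem p₁ (hparent p₁ hp₁) p₂
    ⟨by lia, hnotMate, Or.inr ⟨x, hp₁, hp₂⟩⟩
  obtain ⟨q, hq⟩ := exists_isParent hconn (v := v) (a := p₁) (by lia)
  have hqd := hq.dist_eq
  have hxm := mate_partner G v x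
  have hxmd := hxm.dist_eq
  have hN : ∀ z, G.Adj p₁ z → z = q ∨ z = x ∨ z = partner G v x := fun z hz => by
    have : z ∈ G.neighborSet p₁ := hz
    rwa [hxm.neighborSet_parent_eq hle (hT.map_ne hxT) hq hp₁] at this
  -- By the valence bound `b` is a parent of `x` or of the mate of `x`, hence of both.
  refine hbT (hparent b ?_)
  rcases hb with hb | ⟨c, hp₁c, hbc⟩
  · rcases hN b hb with rfl | rfl | rfl <;> lia
  · rcases hN c hp₁c.adj with rfl | rfl | rfl
    · have := hp₁c.dist_eq
      lia
    · exact hbc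
    · exact hxm.symm.isParent hbc

theorem eq_root (hconn : G.Connected) (hle : ∀ u, G.valence u ≤ 3) (hv : G.valence v = 3)
    (htype : G.IsTypeOne v) (hT : IsSelection G v T) (hx : IsRootLike G v T x) : x = v := by
  have h₁ := hx.dist_ne_one hconn (finite_of_encard_le_coe (hle v)) htype hT
  have h₂ := hx.dist_ne_two hconn hle hv htype hT
  have h₃ := hx.dist_lt_three hconn hle hv htype hT
  exact (hconn.dist_eq_zero_iff.1 (by lia : G.dist v x = 0)).symm

end IsRootLike

theorem eq_of_preserves_blackSet_of_fixes_root (hconn : G.Connected)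
    (hle : ∀ u, G.valence u ≤ 3) (htype : G.IsTypeOne v) (hT : IsSelection G v T) {φ : G ≃g G}
    (hφ : ∀ u, φ u ∈ blackSet G v T ↔ u ∈ blackSet G v T) (hφv : φ v = v) (u : V) :
    φ u = u := by
  induction hn : G.dist v u using Nat.strong_induction_on generalizing u with
  | _ n ih =>
    have hmate : Mate G v u (φ u) := ⟨φ, hφv, fun w hw => ih _ (hn ▸ hw) w rfl, rfl⟩
    by_contra hne
    have hpartner := hmate.eq_partner hconn hle htype hne
    have hu : 2 ≤ G.dist v u := two_le_dist_of_partner_ne hconn htype (hpartner ▸ hne)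
    have hiff := hφ u
    rw [mem_blackSet_iff hu, mem_blackSet_iff (hmate.dist_eq.symm ▸ hu), hpartner] at hiff
    rcases hT.mem_or_map_mem u (hpartner ▸ hne) with h | h
    · exact hT.map_notMem u h (hiff.2 h)
    · exact hT.map_notMem u (hiff.1 h) h

theorem exists_isDistinguishing_fin_two (hconn : G.Connected) (hle : ∀ u, G.valence u ≤ 3)
    (hv : G.valence v = 3) (htype : G.IsTypeOne v) :
    ∃ c : V → Fin 2, G.IsDistinguishing c := by
  classical
  obtain ⟨T, hT⟩ := exists_isSelection hconn hle htype
  refine ⟨fun u => if u ∈ blackSet G v T then 1 else 0, fun φ hφ => ?_⟩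
  have hblack : ∀ u, φ u ∈ blackSet G v T ↔ u ∈ blackSet G v T := fun u => by
    have hcolor := hφ u
    by_cases hu : u ∈ blackSet G v T <;> simpa [hu] using hcolor
  have hroot : φ v = v := (isRootLike_apply_root hblack).eq_root hconn hle hv htype hT
  exact eq_of_preserves_blackSet_of_fixes_root hconn hle htype hT hblack hroot

end Coloring

section DistinguishingNumber

variable {V : Type*} {G : SimpleGraph V}

theorem distinguishingNumber_le {n : ℕ} {c : V → Fin n} (hc : G.IsDistinguishing c) :
    G.distinguishingNumber ≤ n :=
  iInf₂_le n ⟨c, hc⟩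

theorem le_distinguishingNumber {k : ℕ}
    (h : ∀ n, ∀ c : V → Fin n, G.IsDistinguishing c → k ≤ n) : k ≤ G.distinguishingNumber :=
  le_iInf₂ fun n ⟨c, hc⟩ => Nat.cast_le.2 (h n c hc)

theorem distinguishingNumber_eq_one [Nonempty V] [Subsingleton (G ≃g G)] :
    G.distinguishingNumber = 1 := by
  refine le_antisymm ?_ (le_distinguishingNumber (k := 1) fun n c _ => ?_)
  · refine distinguishingNumber_le (n := 1) (c := fun _ => 0) fun φ _ u => ?_
    rw [Subsingleton.elim φ Iso.refl]
    rfl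
  · exact Fin.pos (c (Classical.arbitrary V))

theorem distinguishingNumber_eq_two [Nontrivial (G ≃g G)] {c : V → Fin 2}
    (hc : G.IsDistinguishing c) : G.distinguishingNumber = 2 := by
  refine le_antisymm (distinguishingNumber_le hc)
    (le_distinguishingNumber (k := 2) fun n c hc => ?_)
  by_contra! hn
  have : Subsingleton (Fin n) := Fin.subsingleton_iff_le_one.2 (by lia)
  obtain ⟨φ, hφ⟩ := exists_ne (Iso.refl : G ≃g G)
  exact hφ (RelIso.ext (hc φ fun _ => Subsingleton.elim _ _))

end DistinguishingNumber

end TypeOneColoring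

open TypeOneColoring

theorem theorem5p3 {V : Type*} (G : SimpleGraph V) (hconn : G.Connected)
    (hmax : G.maxValence = 3) (v : V) (hv : G.valence v = 3) (htype : G.IsTypeOne v) :
    (Nontrivial (G ≃g G) → G.distinguishingNumber = 2) ∧
      (¬ Nontrivial (G ≃g G) → G.distinguishingNumber = 1) := by
  have hle : ∀ u, G.valence u ≤ 3 := fun u => (le_iSup G.valence u).trans hmax.le
  refine ⟨fun _ => ?_, fun htrivial => ?_⟩
  · obtain ⟨c, hc⟩ := exists_isDistinguishing_fin_two hconn hle hv htype
    exact distinguishingNumber_eq_two hc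
  · have := not_nontrivial_iff_subsingleton.1 htrivial
    have : Nonempty V := ⟨v⟩
    exact distinguishingNumber_eq_one
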